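/- Let $R$ be a normal domain, that is, an integral domain that is integrally closed in its field of fractions. Conventions. Let $M$ be a finitely generated torsionfree $R$-module of rank $e$ (the maximal number of linearly independent elements), with an embedding $\varphi : M \hookrightarrow R^e$ (one always exists). The Rees algebra $\mathcal R(M)$ is the $R$-subalgebra of the polynomial ring $R[T_1,\dots,T_e]$ generated by all linear forms $a_1T_1+\cdots+a_eT_e$ with $(a_1,\dots,a_e)\in\varphi(M)$; write $\mathcal R(M)=\bigoplus_{n\ge 0}M_n$, where $M_n$ is the $R$-module of homogeneous elements of degree $n$ of $\mathcal R(M)$. A submodule $N$ of $R^e$ containing $\varphi(M)$ is integral over $M$ if the subalgebra of $R[T_1,\dots,T_e]$ generated by the linear forms of the elements of $N$ is integral over $\mathcal R(M)$. The integral closure $\overline M$ of $M$ is the largest submodule of $R^e$ that is integral over $M$, and $M$ is integrally closed if $\overline M=\varphi(M)$. Proposition 4.1. Let $E$ be a finitely generated torsionfree $R$-module of rank $e$ with an embedding $E\hookrightarrow R^e$, and let $\mathcal R(E)=\bigoplus_{n\ge0}E_n$ be its Rees algebra. For every $n\ge 0$ let an embedding of the (finitely generated torsionfree) $R$-module $E_n$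 into the free $R$-module of the same rank be given. Then the ring $\mathcal R(E)$ is integrally closed in its field of fractions if and only if, for every $n\ge0$, the module $E_n$ is integrally closed with respect to the given embedding. -/

import Mathlib

namespace ModuleRees

variable {R : Type*} [CommRing R]

/-- The linear form `a₁ T₁ + ⋯ + aₑ Tₑ` in the polynomial ring `R[T₁, …, Tₑ]` attached to a vector
`(a₁, …, aₑ)` of the free module `R ^ e`. -/
noncomputable def linForm {e : ℕ} : (Fin e → R) →ₗ[R] MvPolynomial (Fin e) R :=
  Fintype.linearCombination R (MvPolynomial.X : Fin e → MvPolynomial (Fin e) R)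

theorem linForm_apply {e : ℕ} (a : Fin e → R) :
    linForm a = ∑ i, MvPolynomial.C (a i) * MvPolynomial.X i := by
  simp [linForm, Fintype.linearCombination_apply, MvPolynomial.smul_eq_C_mul]

/-- The `R`-subalgebra of `R[T₁, …, Tₑ]` generated by the linear forms of the elements of a
submodule `U` of `R ^ e`. When `U` has rank `e`, this is the Rees algebra of `U`. -/
noncomputable def formAlgebra {e : ℕ} (U : Submodule R (Fin e → R)) :
    Subalgebra R (MvPolynomial (Fin e) R) :=
  Algebra.adjoin R (linForm '' (U : Set (Fin e → R)))

/-- For submodules `U ≤ M` of `R ^ e`, the module `M` is integral over `U`: every element of the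
algebra generated by the linear forms of `M` is integral over the subalgebra generated by those
of `U`. -/
def IsIntegralOver {e : ℕ} (M U : Submodule R (Fin e → R)) : Prop :=
  U ≤ M ∧ ∀ z ∈ formAlgebra M, IsIntegral (formAlgebra U) z

/-- The integral closure of a submodule `U` of `R ^ e`: the largest submodule of `R ^ e` which is
integral over `U` (see `isGreatest_modIntegralClosure`). -/
noncomputable def modIntegralClosure {e : ℕ} (U : Submodule R (Fin e → R)) :
    Submodule R (Fin e → R) :=
  sSup {M | IsIntegralOver M U}

theorem isGreatest_modIntegralClosure {e : ℕ} (U : Submodule R (Fin e → R)) :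
    IsGreatest {M | IsIntegralOver M U} (modIntegralClosure U) := by
  have hU : IsIntegralOver U U :=
    ⟨le_rfl, fun z hz => isIntegral_algebraMap (R := formAlgebra U) (x := ⟨z, hz⟩)⟩
  refine ⟨⟨le_sSup hU, fun z hz => ?_⟩, fun M hM => le_sSup hM⟩
  have key : modIntegralClosure U ≤ ((integralClosure (formAlgebra U)
      (MvPolynomial (Fin e) R)).restrictScalars R).toSubmodule.comap linForm :=
    sSup_le fun M hM x hx => hM.2 _ (Algebra.subset_adjoin ⟨x, hx, rfl⟩)
  have h2 : formAlgebra (modIntegralClosure U) ≤ (integralClosure (formAlgebra U)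
      (MvPolynomial (Fin e) R)).restrictScalars R := by
    refine Algebra.adjoin_le ?_
    rintro _ ⟨x, hx, rfl⟩
    exact key hx
  exact h2 hz

section Embedded

variable {E : Type*} [AddCommGroup E] [Module R E]

/-- A finitely generated torsionfree module over a domain embeds into a free module of the same
rank. -/
theorem exists_embedding [IsDomain R] [Module.Finite R E] [Module.IsTorsionFree R E] :
    ∃ φ : E →ₗ[R] (Fin (Module.finrank R E) → R), Function.Injective φ := by
  obtain ⟨s, hs, hli⟩ := exists_set_linearIndependent R E
  have hfin : Module.rank R E < Cardinal.aleph0 := Module.rank_lt_aleph0 R E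
  have : Finite s := Cardinal.lt_aleph0_iff_finite.1 (hs ▸ hfin)
  have hcard : Nat.card s = Module.finrank R E := by
    simp [Nat.card, hs, Module.finrank]
  set N := Submodule.span R (Set.range ((↑) : s → E)) with hN
  have hrank : Module.rank R N = Module.rank R E := by
    rw [hN, rank_span hli, Subtype.range_coe, hs]
  have htor : Module.IsTorsion R (E ⧸ N) := by
    rw [← Module.rank_eq_zero_iff_isTorsion]
    have h := Submodule.rank_quotient_add_rank N
    rw [hrank] at h
    obtain ⟨r, hr⟩ := Cardinal.lt_aleph0.1 hfin
    have hq : Module.rank R (E ⧸ N) < Cardinal.aleph0 := Module.rank_lt_aleph0 R _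
    obtain ⟨q, hq⟩ := Cardinal.lt_aleph0.1 hq
    rw [hr, hq] at h
    rw [hq]
    norm_cast at h ⊢
    omega
  obtain ⟨d, hd0, hd⟩ : ∃ d : R, d ≠ 0 ∧ ∀ x : E, d • x ∈ N := by
    obtain ⟨d, hd, hd'⟩ := Submodule.annihilator_top_inter_nonZeroDivisors htor
    refine ⟨d, nonZeroDivisors.ne_zero hd', fun x => ?_⟩
    have := Submodule.mem_annihilator.1 hd (Submodule.Quotient.mk x) Submodule.mem_top
    rwa [← Submodule.Quotient.mk_smul, Submodule.Quotient.mk_eq_zero] at this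
  let f : E →ₗ[R] N := (LinearMap.lsmul R E d).codRestrict N hd
  let b := Module.Basis.span hli
  let eqv : s ≃ Fin (Module.finrank R E) := (Finite.equivFin s).trans (finCongr hcard)
  have : Fintype s := Fintype.ofFinite s
  refine ⟨((b.reindex eqv).equivFun.toLinearMap).comp f, ?_⟩
  rw [LinearMap.coe_comp]
  refine (LinearEquiv.injective _).comp fun x y hxy => ?_
  have h : d • x = d • y := congrArg Subtype.val hxy
  exact smul_right_injective E hd0 h

/-- The Rees algebra of a module `E` with an embedding `φ` into `R ^ e`: the `R`-subalgebra of the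
polynomial ring `R[T₁, …, Tₑ]` generated by the linear forms of the vectors `φ x`, `x ∈ E`. -/
noncomputable def reesAlg {e : ℕ} (φ : E →ₗ[R] (Fin e → R)) :
    Subalgebra R (MvPolynomial (Fin e) R) :=
  formAlgebra (LinearMap.range φ)

/-- The degree `n` component `E_n` of the Rees algebra of `E`. -/
noncomputable def reesComp {e : ℕ} (φ : E →ₗ[R] (Fin e → R)) (n : ℕ) :
    Submodule R (MvPolynomial (Fin e) R) :=
  (reesAlg φ).toSubmodule ⊓ MvPolynomial.homogeneousSubmodule (Fin e) R n

/-- A module `E`, with an embedding `φ` into `R ^ e`, is integrally closed if it equals its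
integral closure in `R ^ e`. -/
def IsIntClosed {e : ℕ} (φ : E →ₗ[R] (Fin e → R)) : Prop :=
  modIntegralClosure (LinearMap.range φ) = LinearMap.range φ

/-- The Rees algebra is generated in degree one: `E_n` is the `n`-th power of the module of linear
forms. -/
theorem reesComp_eq_pow {e : ℕ} (φ : E →ₗ[R] (Fin e → R)) (n : ℕ) :
    reesComp φ n = (LinearMap.range (linForm ∘ₗ φ)) ^ n := by
  classical
  have hhom : ∀ m : ℕ, (LinearMap.range (linForm ∘ₗ φ)) ^ m ≤
      MvPolynomial.homogeneousSubmodule (Fin e) R m := by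
    have h1 : LinearMap.range (linForm ∘ₗ φ) ≤
        MvPolynomial.homogeneousSubmodule (Fin e) R 1 := by
      rintro _ ⟨x, rfl⟩
      rw [LinearMap.comp_apply, linForm_apply]
      refine Submodule.sum_mem _ fun i _ => ?_
      have h := (MvPolynomial.isHomogeneous_C (Fin e) (φ x i)).mul
        (MvPolynomial.isHomogeneous_X R i)
      rwa [zero_add] at h
    intro m
    induction m with
    | zero =>
      rw [pow_zero, Submodule.one_le]
      exact MvPolynomial.isHomogeneous_one _ _
    | succ k ih =>
      rw [pow_succ]
      refine Submodule.mul_le.2 fun x hx y hy => ?_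
      exact MvPolynomial.IsHomogeneous.mul (ih hx) (h1 hy)
  have hset : (linForm '' (LinearMap.range φ : Set (Fin e → R))) =
      (LinearMap.range (linForm ∘ₗ φ) : Set (MvPolynomial (Fin e) R)) := by
    ext z; simp
  have hle : ∀ m : ℕ, (LinearMap.range (linForm ∘ₗ φ)) ^ m ≤ (reesAlg φ).toSubmodule := by
    intro m
    induction m with
    | zero => rw [pow_zero, Submodule.one_le]; exact one_mem (reesAlg φ)
    | succ k ih =>
      rw [pow_succ]
      refine Submodule.mul_le.2 fun x hx y hy => (reesAlg φ).mul_mem (ih hx) ?_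
      exact Algebra.subset_adjoin (hset ▸ hy)
  refine le_antisymm ?_ (le_inf (hle n) (hhom n))
  -- every homogeneous component of an element of the algebra lies in the corresponding power
  have key : ∀ z ∈ reesAlg φ, ∀ m : ℕ,
      MvPolynomial.homogeneousComponent m z ∈ (LinearMap.range (linForm ∘ₗ φ)) ^ m := by
    intro z hz
    have hz' : z ∈ ⨆ m : ℕ, (LinearMap.range (linForm ∘ₗ φ)) ^ m := by
      rw [reesAlg, formAlgebra, hset] at hz
      have := Algebra.adjoin_eq_span R
        (LinearMap.range (linForm ∘ₗ φ) : Set (MvPolynomial (Fin e) R))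
      rw [← Subalgebra.mem_toSubmodule, this] at hz
      refine Submodule.span_le.2 ?_ hz
      intro w hw
      induction hw using Submonoid.closure_induction with
      | mem x hx => exact Submodule.mem_iSup_of_mem 1 (by simpa using hx)
      | one => exact Submodule.mem_iSup_of_mem 0 (by rw [pow_zero]; exact Submodule.one_le.1 le_rfl)
      | mul x y _ _ hx hy =>
        have : x * y ∈ (⨆ m : ℕ, (LinearMap.range (linForm ∘ₗ φ)) ^ m) *
            (⨆ m : ℕ, (LinearMap.range (linForm ∘ₗ φ)) ^ m) := Submodule.mul_mem_mul hx hy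
        rw [Submodule.iSup_mul] at this
        refine (show _ ≤ ⨆ m : ℕ, (LinearMap.range (linForm ∘ₗ φ)) ^ m from
          iSup_le fun i => ?_) this
        rw [Submodule.mul_iSup]
        refine iSup_le fun j => ?_
        rw [← pow_add]
        exact le_iSup (fun m : ℕ => (LinearMap.range (linForm ∘ₗ φ)) ^ m) (i + j)
    intro m
    have : (⨆ m : ℕ, (LinearMap.range (linForm ∘ₗ φ)) ^ m) ≤
        ((LinearMap.range (linForm ∘ₗ φ)) ^ m).comap (MvPolynomial.homogeneousComponent m) := by
      refine iSup_le fun k w hw => ?_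
      rw [Submodule.mem_comap, MvPolynomial.homogeneousComponent_of_mem (hhom k hw)]
      split_ifs with h
      · exact h ▸ hw
      · exact zero_mem _
    exact this hz'
  rintro z ⟨hz, hzn⟩
  have := key z hz n
  rwa [MvPolynomial.homogeneousComponent_of_mem hzn, if_pos rfl] at this

/-- The components of the Rees algebra of a finitely generated module are finitely generated; being
submodules of a polynomial ring they are torsionfree over a domain, so `exists_embedding` applies
to them. -/
instance finite_reesComp [Module.Finite R E] {e : ℕ} (φ : E →ₗ[R] (Fin e → R)) (n : ℕ) :
    Module.Finite R (reesComp φ n) := by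
  rw [Module.Finite.iff_fg, reesComp_eq_pow, ← Submodule.map_top]
  exact (Module.Finite.fg_top.map _).pow n

end Embedded

end ModuleRees

open MvPolynomial

/-! ### Integrality along ring homomorphisms -/

namespace RingHom

/-! The module `E_n` sits in two unrelated places: in degree `n` of `R[T]`, and in a free module
through `ψ n`. Both integral closures are described by one valuative criterion over `K = Frac R`.
For a finitely generated `U` of full rank, a homogeneous `z` of degree `n` in `K[T]` is integral
over the algebra of `U` iff it lies in the `n`-th power of the `V`-span of `U`, for every valuation
ring `V` of `K` containing `R` (`isIntegralElem_of_forall_mem`,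
`homogeneousComponent_mem_formSpan_pow`).

As `E_n` is the `n`-th power of the module of linear forms, its `V`-span in `K[T]` is the `n`-th
power of the `V`-span of `E` (`span_range_reesCompToField`). So the criterion in degree `n` for `E`
and in degree one for `E_n` both ask whether a fraction `a / d` with `a` in `E_n` lies in the
`V`-span of `E_n`. This can be decided inside `K ⊗ E_n`, hence for any embedding
(`smul_mem_span_range_of_injective`): the two closures of `E_n` consist of the same fractions.

Normality of `K[T]` confines the closure of the Rees algebra to `K[T]`, and normality of `R`
confines the closure of `E_n` in `K ^ m` to `R ^ m`. -/

theorem IsIntegralElem.of_forall_mem_range {A B C : Type*} [CommRing A] [CommRing B] [CommRing C]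
    {f : A →+* B} (hf : Function.Injective f) {g : C →+* B} (hg : ∀ c, g c ∈ f.range) {x : B}
    (hx : g.IsIntegralElem x) : f.IsIntegralElem x := by
  let e : A ≃+* f.range := RingEquiv.ofBijective f.rangeRestrict
    ⟨fun a b h => hf (congrArg Subtype.val h), f.rangeRestrict_surjective⟩
  refine IsIntegralElem.of_comp (f := e.symm.toRingHom.comp (g.codRestrict f.range hg)) ?_
  convert hx
  ext c
  exact congrArg Subtype.val (e.apply_symm_apply ⟨g c, hg c⟩)

end RingHom

/-! ### Spans over a valuation ring, independent of the embedding -/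

namespace Submodule

variable {R K : Type*} [CommRing R] [Field K] [Algebra R K]
  {M P Q : Type*} [AddCommGroup M] [Module R M]
  [AddCommGroup P] [Module K P] [Module R P] [IsScalarTower R K P]
  [AddCommGroup Q] [Module K Q] [Module R Q] [IsScalarTower R K Q]

open TensorProduct in
-- The span is the image of a lattice in `K ⊗ M` that does not involve `f`.
theorem span_range_eq_map_liftBaseChange (V : ValuationSubring K) (f : M →ₗ[R] P) :
    span V (Set.range f) = (span V (Set.range (TensorProduct.mk R K M 1))).map
      ((f.liftBaseChange K).restrictScalars V) := by
  rw [map_span, ← Set.range_comp]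
  congr 2
  ext m
  simp

variable [IsDomain R] [IsFractionRing R K]

open TensorProduct in
-- `K ⊗ M` is the localization of `M` at the nonzero elements: a nonzero multiple of any tensor
-- comes from `M`, where `f` detects zero.
theorem liftBaseChange_injective {f : M →ₗ[R] P} (hf : Function.Injective f) :
    Function.Injective (f.liftBaseChange K) := by
  rw [injective_iff_map_eq_zero]
  intro t ht
  obtain ⟨⟨m, s⟩, hs⟩ := IsLocalizedModule.surj (nonZeroDivisors R) (TensorProduct.mk R K M 1) t
  have h1 : f m = 0 := by
    have := congrArg (f.liftBaseChange K) hs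
    have h2 : (f.liftBaseChange K) (s • t) = (s : R) • (f.liftBaseChange K) t :=
      (f.liftBaseChange K).map_smul_of_tower (s : R) t
    rw [h2, ht, smul_zero] at this
    simpa using this.symm
  have h3 : m = 0 := hf (by rw [h1, map_zero])
  rw [h3, map_zero] at hs
  have h4 : algebraMap R K s • t = 0 := by rw [algebraMap_smul]; exact hs
  exact (smul_eq_zero.1 h4).resolve_left
    (IsFractionRing.to_map_ne_zero_of_mem_nonZeroDivisors s.2)

/-- Membership of a fraction in the module generated over a valuation ring by the image of an
embedding does not depend on the embedding. -/
theorem smul_mem_span_range_of_injective (V : ValuationSubring K) {f : M →ₗ[R] P}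
    (hf : Function.Injective f) (g : M →ₗ[R] Q) {d : K} {a : M}
    (h : d • f a ∈ span V (Set.range f)) : d • g a ∈ span V (Set.range g) := by
  rw [span_range_eq_map_liftBaseChange] at h ⊢
  obtain ⟨t, ht, hta⟩ := h
  have : t = d ⊗ₜ[R] a := by
    apply liftBaseChange_injective (K := K) hf
    simpa using hta
  exact ⟨t, ht, by simp [this]⟩

/-- Common denominators. The fraction `a / d` can then be carried from one embedding of `M` to
another. -/
theorem exists_eq_inv_smul_of_mem_span_range (V : ValuationSubring K) (f : M →ₗ[R] P) {z : P}
    (hz : z ∈ span V (Set.range f)) :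
    ∃ (d : R) (a : M), d ≠ 0 ∧ z = (algebraMap R K d)⁻¹ • f a := by
  induction hz using span_induction with
  | mem x hx =>
    obtain ⟨a, rfl⟩ := hx
    exact ⟨1, a, one_ne_zero, by simp⟩
  | zero => exact ⟨1, 0, one_ne_zero, by simp⟩
  | add x y _ _ hx hy =>
    obtain ⟨d, a, hd, rfl⟩ := hx
    obtain ⟨d', a', hd', rfl⟩ := hy
    have h : algebraMap R K d ≠ 0 := by simpa using hd
    have h' : algebraMap R K d' ≠ 0 := by simpa using hd'
    refine ⟨d * d', d' • a + d • a', mul_ne_zero hd hd', ?_⟩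
    rw [map_add, map_smul, map_smul, ← algebraMap_smul K d', ← algebraMap_smul K d, smul_add,
      smul_smul, smul_smul, map_mul]
    congr 2 <;> field_simp
  | smul v x _ hx =>
    obtain ⟨d, a, hd, rfl⟩ := hx
    obtain ⟨p, q, hq, hv⟩ := IsFractionRing.div_surjective (A := R) (v : K)
    have hq := nonZeroDivisors.ne_zero hq
    refine ⟨q * d, p • a, mul_ne_zero hq hd, ?_⟩
    rw [map_smul, ← algebraMap_smul K p, smul_smul, map_mul]
    change (v : K) • ((algebraMap R K d)⁻¹ • f a) = _
    rw [← hv, smul_smul]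
    congr 1
    field_simp

end Submodule

namespace ModuleRees

/-! ### The valuative criterion for integrality over a Rees algebra -/

section Lattice

variable {R K : Type*} [CommRing R] [Field K] [Algebra R K] {e : ℕ}

/-- The inclusion of a Rees algebra into the polynomial ring over the field `K`. -/
noncomputable def formAlgebraToField (K : Type*) [Field K] [Algebra R K]
    (U : Submodule R (Fin e → R)) : formAlgebra U →+* MvPolynomial (Fin e) K :=
  (MvPolynomial.map (algebraMap R K)).comp (formAlgebra U).val.toRingHom

theorem formAlgebraToField_apply (U : Submodule R (Fin e → R)) (a : formAlgebra U) :
    formAlgebraToField K U a = MvPolynomial.map (algebraMap R K) a := rfl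

theorem formAlgebraToField_injective [FaithfulSMul R K] (U : Submodule R (Fin e → R)) :
    Function.Injective (formAlgebraToField K U) :=
  (map_injective _ (FaithfulSMul.algebraMap_injective R K)).comp Subtype.val_injective

/-- The coordinatewise inclusion of `R ^ e` into `K ^ e`. -/
def vecMap (R K : Type*) [CommRing R] [Field K] [Algebra R K] (e : ℕ) :
    (Fin e → R) →ₗ[R] (Fin e → K) :=
  (Algebra.linearMap R K).compLeft (Fin e)

theorem vecMap_apply (u : Fin e → R) (i : Fin e) : vecMap R K e u i = algebraMap R K (u i) := rfl

theorem map_linForm (u : Fin e → R) :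
    MvPolynomial.map (algebraMap R K) (linForm u) = linForm (vecMap R K e u) := by
  simp [linForm_apply, vecMap_apply]

theorem linForm_injective {R : Type*} [CommRing R] :
    Function.Injective (linForm : (Fin e → R) → MvPolynomial (Fin e) R) := by
  intro a b h
  ext i
  have := congrArg (coeff (Finsupp.single i 1)) h
  simpa [linForm_apply, coeff_sum, coeff_C_mul, coeff_X, Finsupp.single_left_inj] using this

theorem linForm_single {R : Type*} [CommRing R] (i : Fin e) :
    linForm (Pi.single i (1 : R)) = X i := by
  simp [linForm_apply, Pi.single_apply]

theorem isHomogeneous_linForm {R : Type*} [CommRing R] (a : Fin e → R) :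
    (linForm a).IsHomogeneous 1 := by
  rw [linForm_apply]
  refine IsHomogeneous.sum _ _ _ fun i _ => ?_
  simpa using (isHomogeneous_C (Fin e) (a i)).mul (isHomogeneous_X R i)

/-- The module generated by `U` over a valuation ring of `K`. -/
def valSpan (V : ValuationSubring K) (U : Submodule R (Fin e → R)) : Submodule V (Fin e → K) :=
  Submodule.span V (vecMap R K e '' U)

/-- The linear forms of the elements of the module generated by `U` over a valuation ring. -/
noncomputable def formSpan (V : ValuationSubring K) (U : Submodule R (Fin e → R)) :
    Submodule V (MvPolynomial (Fin e) K) :=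
  (valSpan V U).map (linForm.restrictScalars V)

theorem linForm_mem_formSpan {V : ValuationSubring K} {U : Submodule R (Fin e → R)}
    {v : Fin e → K} : linForm v ∈ formSpan V U ↔ v ∈ valSpan V U :=
  linForm_injective.mem_set_image (s := (valSpan V U : Set (Fin e → K)))

theorem isHomogeneous_of_mem_formSpan_pow {V : ValuationSubring K} {U : Submodule R (Fin e → R)}
    (n : ℕ) {z : MvPolynomial (Fin e) K} (hz : z ∈ formSpan V U ^ n) : z.IsHomogeneous n := by
  induction n generalizing z with
  | zero =>
    rw [pow_zero] at hz
    obtain ⟨c, rfl⟩ := Submodule.mem_one.1 hz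
    exact isHomogeneous_C (Fin e) (c : K)
  | succ n ih =>
    rw [pow_succ] at hz
    induction hz using Submodule.mul_induction_on' with
    | mem_mul_mem x hx y hy =>
      obtain ⟨w, -, rfl⟩ := hy
      exact (ih hx).mul (isHomogeneous_linForm w)
    | add x _ y _ hx hy => exact hx.add hy

/-- An element lying in the module generated over each valuation ring is integral over the Rees
algebra. -/
theorem isIntegralElem_of_forall_mem [FaithfulSMul R K] {U : Submodule R (Fin e → R)} {n : ℕ}
    {z : MvPolynomial (Fin e) K}
    (hz : ∀ V : ValuationSubring K, (∀ r : R, algebraMap R K r ∈ V) → z ∈ formSpan V U ^ n) :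
    (formAlgebraToField K U).IsIntegralElem z := by
  let L := FractionRing (MvPolynomial (Fin e) K)
  let i : MvPolynomial (Fin e) K →+* L := algebraMap _ L
  have hi : Function.Injective i := IsFractionRing.injective _ L
  let f : formAlgebra U →+* L := i.comp (formAlgebraToField K U)
  have hf : Function.Injective f := hi.comp (formAlgebraToField_injective U)
  refine RingHom.IsIntegralElem.of_map (g := i) hi ?_
  -- In a field, the integral closure of a subring is the intersection of the valuation rings
  -- containing it. Such a `W` in `L` is handled through its trace `V` on `K`: `W` contains `V` and
  -- the linear forms of `U`, hence all powers of their `V`-span.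
  have hmem : i z ∈ (integralClosure (Subring.closure (f.range : Set L)) L).toSubring := by
    rw [← iInf_valuationSubring_superset, Subring.mem_iInf]
    rintro ⟨W, hW⟩
    let V : ValuationSubring K := W.comap (i.comp C)
    have hR : ∀ r : R, algebraMap R K r ∈ V := by
      intro r
      refine hW ⟨algebraMap R _ r, ?_⟩
      change i (MvPolynomial.map _ (C r)) = i (C _)
      rw [map_C]
    have hlin : ∀ v ∈ valSpan V U, i (linForm v) ∈ W := by
      intro v hv
      induction hv using Submodule.span_induction with
      | mem x hx =>
        obtain ⟨u, hu, rfl⟩ := hx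
        refine hW ⟨⟨linForm u, Algebra.subset_adjoin ⟨u, hu, rfl⟩⟩, ?_⟩
        exact congrArg i (map_linForm u)
      | zero => simp
      | add x y _ _ hx hy => rw [map_add, map_add]; exact add_mem hx hy
      | smul c x _ hx =>
        change i (linForm ((c : K) • x)) ∈ W
        rw [map_smul, smul_eq_C_mul, map_mul]
        exact mul_mem c.2 hx
    have hpow : ∀ n, ∀ w ∈ formSpan V U ^ n, i w ∈ W := by
      intro n
      induction n with
      | zero =>
        intro w hw
        rw [pow_zero] at hw
        obtain ⟨c, rfl⟩ := Submodule.mem_one.1 hw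
        exact c.2
      | succ n ih =>
        intro w hw
        rw [pow_succ] at hw
        induction hw using Submodule.mul_induction_on' with
        | mem_mul_mem x hx y hy =>
          obtain ⟨v, hv, rfl⟩ := hy
          rw [map_mul]
          exact mul_mem (ih x hx) (hlin v hv)
        | add x _ y _ hx hy => rw [map_add]; exact add_mem hx hy
    exact hpow n z (hz V hR)
  have h2 : (Subring.closure (f.range : Set L)).subtype.IsIntegralElem (i z) := hmem
  refine h2.of_forall_mem_range hf fun c => ?_
  exact (Subring.closure_eq f.range).le c.2

/-- The homogeneous components of an element integral over the Rees algebra of a module of full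
rank lie in the powers of the module generated over each valuation ring. -/
theorem homogeneousComponent_mem_formSpan_pow {U : Submodule R (Fin e → R)} (hfg : U.FG)
    (hU : Submodule.span K (vecMap R K e '' U) = ⊤) {z : MvPolynomial (Fin e) K}
    (hz : (formAlgebraToField K U).IsIntegralElem z) (V : ValuationSubring K)
    (hV : ∀ r : R, algebraMap R K r ∈ V) (n : ℕ) :
    homogeneousComponent n z ∈ formSpan V U ^ n := by
  classical
  let W := valSpan V U
  let fV : R →+* V := (algebraMap R K).codRestrict V.toSubring hV
  have hWfin : Module.Finite V W := by
    obtain ⟨s, rfl⟩ := hfg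
    rw [Module.Finite.iff_fg]
    refine ⟨s.image (vecMap R K e), le_antisymm ?_ ?_⟩
    · refine Submodule.span_mono ?_
      rw [Finset.coe_image]
      exact Set.image_mono Submodule.subset_span
    · refine Submodule.span_le.2 ?_
      rintro _ ⟨u, hu, rfl⟩
      induction hu using Submodule.span_induction with
      | mem x hx => exact Submodule.subset_span (by simpa using ⟨x, hx, rfl⟩)
      | zero => simp
      | add x y _ _ hx hy => rw [map_add]; exact add_mem hx hy
      | smul c x _ hx =>
        have : vecMap R K e (c • x) = fV c • vecMap R K e x := by
          ext i
          exact map_mul (algebraMap R K) c (x i)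
        rw [this]
        exact Submodule.smul_mem _ _ hx
  -- Over the Bézout ring `V` torsionfree means flat, and over a local ring finite flat means free.
  -- A `V`-basis of `W` is then a `K`-basis of `K ^ e`, because `U` has full rank.
  have hflat : Module.Flat V W := by
    rw [Module.Flat.flat_iff_torsion_eq_bot_of_isBezout,
      ← Submodule.isTorsionFree_iff_torsion_eq_bot]
    infer_instance
  have hfree : Module.Free V W := Module.free_of_flat_of_isLocalRing
  let ι := Module.Free.ChooseBasisIndex V W
  let b : Module.Basis ι V W := Module.Free.chooseBasis V W
  have hli : LinearIndependent K (fun i => (b i : Fin e → K)) := by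
    rw [← LinearIndependent.iff_fractionRing (R := V)]
    exact b.linearIndependent.map' W.subtype W.ker_subtype
  have hsp : ⊤ ≤ Submodule.span K (Set.range fun i => (b i : Fin e → K)) := by
    rw [← hU, Submodule.span_le]
    intro x hx
    have hxW : x ∈ W := Submodule.subset_span hx
    have h1 : (⟨x, hxW⟩ : W) = ∑ i, b.repr ⟨x, hxW⟩ i • b i := (b.sum_repr _).symm
    have h2 : x = ∑ i, (b.repr ⟨x, hxW⟩ i : K) • (b i : Fin e → K) := by
      conv_lhs => rw [show x = ((⟨x, hxW⟩ : W) : Fin e → K) from rfl, h1]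
      rw [Submodule.coe_sum]
      rfl
    rw [SetLike.mem_coe, h2]
    exact Submodule.sum_mem _ fun i _ => Submodule.smul_mem _ _ (Submodule.subset_span ⟨i, rfl⟩)
  let bK : Module.Basis ι K (Fin e → K) := Module.Basis.mk hli hsp
  have hbK : ∀ i, bK i = b i := fun i => Module.Basis.mk_apply hli hsp i
  -- `σ` and `τ` are the linear changes of variables to and from the basis `b`. In the new variables
  -- the algebra of `U` has coefficients in `V`.
  let τ : MvPolynomial ι K →ₐ[K] MvPolynomial (Fin e) K := aeval fun i => linForm (bK i)
  let lin : (ι → K) →ₗ[K] MvPolynomial ι K := Fintype.linearCombination K X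
  have hlin : ∀ c, lin c = ∑ i, C (c i) * X i := fun c => by
    simp [lin, Fintype.linearCombination_apply, smul_eq_C_mul]
  let σ : MvPolynomial (Fin e) K →ₐ[K] MvPolynomial ι K :=
    aeval fun j => lin (bK.equivFun (Pi.single j 1))
  have hσ : ∀ w, σ (linForm w) = lin (bK.equivFun w) := by
    intro w
    have : σ.toLinearMap ∘ₗ linForm = lin ∘ₗ bK.equivFun.toLinearMap := by
      refine (Pi.basisFun K (Fin e)).ext fun j => ?_
      simp [linForm_single, σ]
    exact LinearMap.congr_fun this w
  have hτlin : ∀ w, τ (lin (bK.equivFun w)) = linForm w := by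
    intro w
    rw [hlin, map_sum]
    conv_rhs => rw [← bK.sum_equivFun w, map_sum]
    refine Finset.sum_congr rfl fun i _ => ?_
    rw [map_mul, map_smul, smul_eq_C_mul, aeval_X, aeval_C, algebraMap_eq]
  have hτσ : ∀ q, τ (σ q) = q := by
    intro q
    have : τ.comp σ = AlgHom.id K _ := by
      ext j : 1
      simp only [AlgHom.comp_apply, AlgHom.id_apply]
      rw [← linForm_single, hσ, hτlin]
    exact DFunLike.congr_fun this q
  have hcoeff : ∀ m, coeff m (σ z) ∈ V := by
    let f : MvPolynomial ι V →+* MvPolynomial ι K := MvPolynomial.map (algebraMap V K)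
    have hf : Function.Injective f := map_injective _ Subtype.val_injective
    have hrange : ∀ a ∈ formAlgebra U,
        σ (MvPolynomial.map (algebraMap R K) a) ∈ f.range := by
      intro a ha
      induction ha using Algebra.adjoin_induction with
      | mem x hx =>
        obtain ⟨u, hu, rfl⟩ := hx
        rw [map_linForm, hσ, hlin]
        have huW : vecMap R K e u ∈ W := Submodule.subset_span ⟨u, hu, rfl⟩
        have hrepr : ∀ i, bK.equivFun (vecMap R K e u) i = (b.repr ⟨_, huW⟩ i : K) := by
          intro i
          have h1 : vecMap R K e u = bK.equivFun.symm fun i => (b.repr ⟨_, huW⟩ i : K) := by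
            rw [Module.Basis.equivFun_symm_apply]
            simp only [hbK]
            conv_lhs => rw [show vecMap R K e u = ((⟨_, huW⟩ : W) : Fin e → K) from rfl,
              ← b.sum_repr ⟨_, huW⟩]
            rw [Submodule.coe_sum]
            rfl
          conv_lhs => rw [h1, LinearEquiv.apply_symm_apply]
        refine sum_mem fun i _ => mul_mem ⟨C (b.repr ⟨_, huW⟩ i), ?_⟩ ⟨X i, by simp [f]⟩
        rw [hrepr]
        simp only [f, map_C]
        rfl
      | algebraMap r =>
        refine ⟨C (fV r), ?_⟩
        simp only [f, map_C, MvPolynomial.algebraMap_eq, σ, aeval_C]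
        rfl
      | add x y _ _ hx hy => rw [map_add, map_add]; exact add_mem hx hy
      | mul x y _ _ hx hy => rw [map_mul, map_mul]; exact mul_mem hx hy
    have h1 : (σ.toRingHom.comp (formAlgebraToField K U)).IsIntegralElem (σ z) :=
      hz.map σ.toRingHom
    have h2 : f.IsIntegralElem (σ z) := 
      RingHom.IsIntegralElem.of_forall_mem_range (f := f) hf
        (g := σ.toRingHom.comp (formAlgebraToField K U)) (fun c => hrange c c.2) h1
    intro m
    let := algebraMvPolynomial (R := V) (S := K) (σ := ι)
    have h3 : IsIntegral (MvPolynomial ι V) (σ z) := h2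
    -- Integrality over `V[X]` is coefficientwise, and the valuation ring `V` is integrally closed.
    obtain ⟨c, hc⟩ := IsIntegrallyClosed.isIntegral_iff.1
      (isIntegral_iff_isIntegral_coeff.1 h3 m)
    rw [← hc]
    exact c.2
  have hbmem : ∀ i, linForm (bK i) ∈ formSpan V U := fun i =>
    linForm_mem_formSpan.2 (by rw [hbK]; exact (b i).2)
  have hterm : ∀ m, τ (monomial m (coeff m (σ z))) ∈ formSpan V U ^ m.degree := by
    intro m
    simp only [τ, aeval_monomial, algebraMap_eq]
    have h1 : (m.prod fun i k => linForm (bK i) ^ k) ∈ formSpan V U ^ m.degree := by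
      rw [Finsupp.degree_apply, ← Finset.prod_pow_eq_pow_sum]
      rw [Finsupp.prod]
      induction m.support using Finset.induction_on with
      | empty => rw [Finset.prod_empty, Finset.prod_empty]; exact Submodule.one_le.1 le_rfl
      | insert i s hi ih =>
        rw [Finset.prod_insert hi, Finset.prod_insert hi]
        exact Submodule.mul_mem_mul (Submodule.pow_mem_pow _ (hbmem i) _) ih
    have h2 := Submodule.smul_mem _ (⟨_, hcoeff m⟩ : V) h1
    rw [← smul_eq_C_mul]
    exact h2
  rw [← hτσ z, ← support_sum_monomial_coeff (σ z), map_sum, map_sum]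
  refine Submodule.sum_mem _ fun m _ => ?_
  rw [homogeneousComponent_of_mem (isHomogeneous_of_mem_formSpan_pow _ (hterm m))]
  split_ifs with h
  · exact h ▸ hterm m
  · exact zero_mem _

end Lattice

end ModuleRees

namespace ModuleRees

/-! ### Full rank over the fraction field -/

section FullRank

variable {R K : Type*} [CommRing R] [IsDomain R] [Field K] [Algebra R K] [IsFractionRing R K]
  {M : Type*} [AddCommGroup M] [Module R M]

/-- A module embedded into the free module of the same rank spans it over the fraction field. -/
theorem span_vecMap_range_eq_top [Module.Finite R M]
    (ψ : M →ₗ[R] (Fin (Module.finrank R M) → R)) (hψ : Function.Injective ψ) :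
    Submodule.span K (vecMap R K _ '' (LinearMap.range ψ : Set (Fin (Module.finrank R M) → R))) = ⊤ := by
  obtain ⟨s, hs, hli⟩ := exists_set_linearIndependent R M
  have hfin : Module.rank R M < Cardinal.aleph0 := Module.rank_lt_aleph0 R M
  have : Finite s := Cardinal.lt_aleph0_iff_finite.1 (hs ▸ hfin)
  let := Fintype.ofFinite s
  have hcard : Fintype.card s = Module.finrank R M := by
    rw [← Nat.card_eq_fintype_card, Nat.card, hs, Module.finrank]
  have hinj : Function.Injective (vecMap R K (Module.finrank R M)) := fun a b h =>
    funext fun i => IsFractionRing.injective R K (congrFun h i)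
  -- An independent set of maximal size stays independent over `K`; its cardinality is the dimension
  -- of the target, so it spans.
  have hliK : LinearIndependent K fun x : s => vecMap R K _ (ψ x) := by
    rw [← LinearIndependent.iff_fractionRing (R := R)]
    exact hli.map' ((vecMap R K _).comp ψ) (LinearMap.ker_eq_bot.2 (hinj.comp hψ))
  rw [eq_top_iff, ← hliK.span_eq_top_of_card_eq_finrank' (by simp [hcard])]
  refine Submodule.span_mono ?_
  rintro _ ⟨x, rfl⟩
  exact ⟨ψ x, ⟨x, rfl⟩, rfl⟩

end FullRank

/-! ### The span of a graded component over a valuation ring -/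

section Components

variable {R K : Type*} [CommRing R] [Field K] [Algebra R K]
  {E : Type*} [AddCommGroup E] [Module R E] {e : ℕ}

/-- The inclusion of a component of the Rees algebra into the polynomial ring over `K`. -/
noncomputable def reesCompToField (K : Type*) [Field K] [Algebra R K] (φ : E →ₗ[R] (Fin e → R))
    (n : ℕ) : reesComp φ n →ₗ[R] MvPolynomial (Fin e) K :=
  (MvPolynomial.mapAlgHom (Algebra.ofId R K)).toLinearMap.comp (reesComp φ n).subtype

/-- Generation in degree one, `reesComp_eq_pow`, persists after passing to `V`-spans. This links the
criterion in degree `n` for `E` to that in degree one for `E_n`. -/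
theorem span_range_reesCompToField (φ : E →ₗ[R] (Fin e → R)) (n : ℕ) (V : ValuationSubring K)
    (hV : ∀ r : R, algebraMap R K r ∈ V) :
    Submodule.span V (Set.range (reesCompToField K φ n)) =
      formSpan V (LinearMap.range φ) ^ n := by
  refine le_antisymm (Submodule.span_le.2 ?_) ?_
  · rintro _ ⟨⟨a, ha'⟩, rfl⟩
    have ha := ha'
    rw [reesComp_eq_pow] at ha
    change MvPolynomial.map (algebraMap R K) a ∈ formSpan V (LinearMap.range φ) ^ n
    clear ha'
    induction n generalizing a with
    | zero =>
      rw [pow_zero] at ha ⊢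
      obtain ⟨r, rfl⟩ := Submodule.mem_one.1 ha
      exact Submodule.mem_one.2 ⟨⟨_, hV r⟩, (map_C (algebraMap R K) r).symm⟩
    | succ n ih =>
      rw [pow_succ] at ha ⊢
      induction ha using Submodule.mul_induction_on' with
      | mem_mul_mem x hx y hy =>
        obtain ⟨w, rfl⟩ := hy
        rw [map_mul]
        refine Submodule.mul_mem_mul (ih x hx) ?_
        rw [LinearMap.comp_apply, map_linForm, linForm_mem_formSpan]
        exact Submodule.subset_span ⟨φ w, ⟨w, rfl⟩, rfl⟩
      | add x _ y _ hx hy => rw [map_add]; exact add_mem hx hy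
  · have hmem : ∀ (m : ℕ) (a), a ∈ (LinearMap.range (linForm ∘ₗ φ)) ^ m →
        MvPolynomial.map (algebraMap R K) a ∈
          Submodule.span V (Set.range (reesCompToField K φ m)) := fun m a ha =>
      Submodule.subset_span ⟨⟨a, by rwa [reesComp_eq_pow]⟩, rfl⟩
    induction n with
    | zero =>
      rw [pow_zero, Submodule.one_le]
      simpa using hmem 0 1 (by rw [pow_zero]; exact Submodule.one_le.1 le_rfl)
    | succ n ih =>
      have h1 : formSpan V (LinearMap.range φ) ≤
          Submodule.span V ((fun w => MvPolynomial.map (algebraMap R K) (linForm (φ w))) ''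
            Set.univ) := by
        rw [formSpan, valSpan, Submodule.map_span]
        refine Submodule.span_mono ?_
        rintro _ ⟨_, ⟨_, ⟨w, rfl⟩, rfl⟩, rfl⟩
        exact ⟨w, trivial, map_linForm _⟩
      rw [pow_succ]
      refine (mul_le_mul' ih h1).trans ?_
      rw [Submodule.span_mul_span, Submodule.span_le]
      rintro _ ⟨_, ⟨⟨a, ha⟩, rfl⟩, _, ⟨w, -, rfl⟩, rfl⟩
      rw [reesComp_eq_pow] at ha
      have := hmem (n + 1) (a * linForm (φ w))
        (by rw [pow_succ]; exact Submodule.mul_mem_mul ha ⟨w, rfl⟩)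
      rwa [map_mul] at this

end Components

/-! ### Integral closure of a module, elementwise -/

section IntegralClosure

variable {R : Type*} [CommRing R] {e : ℕ}

/-- Integral elements form a subalgebra, so the vectors with integral linear form are a submodule,
itself integral over `U`. -/
theorem mem_modIntegralClosure_iff {U : Submodule R (Fin e → R)} {v : Fin e → R} :
    v ∈ modIntegralClosure U ↔ IsIntegral (formAlgebra U) (linForm v) := by
  refine ⟨fun hv => (isGreatest_modIntegralClosure U).1.2 _ (Algebra.subset_adjoin ⟨v, hv, rfl⟩),
    fun hv => ?_⟩
  let I := (integralClosure (formAlgebra U) (MvPolynomial (Fin e) R)).restrictScalars R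
  have hle : IsIntegralOver (I.toSubmodule.comap linForm) U := by
    refine ⟨fun u hu => ?_, fun z hz => ?_⟩
    · exact isIntegral_algebraMap (R := formAlgebra U)
        (x := ⟨linForm u, Algebra.subset_adjoin ⟨u, hu, rfl⟩⟩)
    · have : formAlgebra (I.toSubmodule.comap linForm) ≤ I := by
        refine Algebra.adjoin_le ?_
        rintro _ ⟨x, hx, rfl⟩
        exact hx
      exact this hz
  exact (isGreatest_modIntegralClosure U).2 hle hv

variable {K : Type*} [Field K] [Algebra R K]

theorem mem_modIntegralClosure_iff_isIntegralElem [FaithfulSMul R K]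
    {U : Submodule R (Fin e → R)} {v : Fin e → R} :
    v ∈ modIntegralClosure U ↔
      (formAlgebraToField K U).IsIntegralElem (linForm (vecMap R K e v)) := by
  rw [mem_modIntegralClosure_iff, ← map_linForm]
  refine ⟨fun h => RingHom.IsIntegralElem.map (f := (formAlgebra U).val.toRingHom) h _, fun h => ?_⟩
  exact RingHom.IsIntegralElem.of_map
    (map_injective _ (FaithfulSMul.algebraMap_injective R K)) h

/-- The form is integral over `R[T]`, so its coefficients are integral over `R`; normality of `R`
enters here. -/
theorem exists_vecMap_eq_of_isIntegralElem [IsDomain R] [IsIntegrallyClosed R]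
    [IsFractionRing R K] {U : Submodule R (Fin e → R)} {w : Fin e → K}
    (hw : (formAlgebraToField K U).IsIntegralElem (linForm w)) :
    ∃ v, vecMap R K e v = w := by
  let := algebraMvPolynomial (R := R) (S := K) (σ := Fin e)
  have h : IsIntegral (MvPolynomial (Fin e) R) (linForm w) := RingHom.IsIntegralElem.of_comp hw
  have hcoeff : ∀ i, coeff (Finsupp.single i 1) (linForm w) = w i := fun i => by
    simp [linForm_apply, coeff_sum, coeff_C_mul, coeff_X, Finsupp.single_left_inj]
  have hint : ∀ i, ∃ r, algebraMap R K r = w i := fun i =>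
    IsIntegrallyClosed.isIntegral_iff.1
      (hcoeff i ▸ isIntegral_iff_isIntegral_coeff.1 h (Finsupp.single i 1))
  choose v hv using hint
  exact ⟨v, funext hv⟩

end IntegralClosure

/-! ### Normality of the Rees algebra, tested in `K[T]` -/

section Normal

variable {R K : Type*} [CommRing R] [IsDomain R] [Field K] [Algebra R K]
  {e : ℕ} {U : Submodule R (Fin e → R)}

/-- The Rees algebra is normal as soon as it contains the elements of `K[T₁, …, Tₑ]` which are
integral over it. -/
theorem isIntegrallyClosed_of_forall_isIntegralElem [FaithfulSMul R K]
    (h : ∀ z, (formAlgebraToField K U).IsIntegralElem z → z ∈ (formAlgebraToField K U).range) :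
    IsIntegrallyClosed (formAlgebra U) := by
  let Q := MvPolynomial (Fin e) K
  let L := FractionRing Q
  let f : formAlgebra U →+* L := (algebraMap Q L).comp (formAlgebraToField K U)
  have hf : Function.Injective f :=
    (IsFractionRing.injective Q L).comp (formAlgebraToField_injective U)
  let g : FractionRing (formAlgebra U) →+* L := IsFractionRing.lift hf
  have hg : ∀ a, g (algebraMap _ _ a) = f a := IsFractionRing.lift_algebraMap hf
  rw [isIntegrallyClosed_iff (FractionRing (formAlgebra U))]
  intro x hx
  have hgx : f.IsIntegralElem (g x) := by
    have := RingHom.IsIntegralElem.map hx g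
    rwa [show g.comp (algebraMap (formAlgebra U) (FractionRing (formAlgebra U))) = f from
      RingHom.ext hg] at this
  -- The factorial ring `K[T]` is normal, so an integral fraction is already a polynomial over `K`.
  have hQ : IsIntegral Q (g x) := RingHom.IsIntegralElem.of_comp hgx
  have : IsIntegrallyClosed Q := UniqueFactorizationMonoid.instIsIntegrallyClosed
  obtain ⟨z, hz⟩ := IsIntegrallyClosed.isIntegral_iff.1 hQ
  rw [← hz] at hgx
  obtain ⟨b, hb⟩ := h z (RingHom.IsIntegralElem.of_map (IsFractionRing.injective Q L) hgx)
  refine ⟨b, g.injective ?_⟩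
  rw [hg, ← hz, ← hb]
  rfl

/-- The denominator `d` makes `z` a fraction `a / d` of the Rees algebra itself, so normality
applies to it. -/
theorem mem_range_of_isIntegralElem [FaithfulSMul R K] [IsIntegrallyClosed (formAlgebra U)]
    {z : MvPolynomial (Fin e) K} {d : R} (hd : d ≠ 0) {a : formAlgebra U}
    (hda : z = (algebraMap R K d)⁻¹ • formAlgebraToField K U a)
    (hz : (formAlgebraToField K U).IsIntegralElem z) : z ∈ (formAlgebraToField K U).range := by
  let Q := MvPolynomial (Fin e) K
  let L := FractionRing Q
  let f : formAlgebra U →+* L := (algebraMap Q L).comp (formAlgebraToField K U)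
  have hf : Function.Injective f :=
    (IsFractionRing.injective Q L).comp (formAlgebraToField_injective U)
  let F := FractionRing (formAlgebra U)
  let g : F →+* L := IsFractionRing.lift hf
  have hg : ∀ a, g (algebraMap _ _ a) = f a := IsFractionRing.lift_algebraMap hf
  have hdK : algebraMap R K d ≠ 0 := by
    simpa using (FaithfulSMul.algebraMap_injective R K).ne hd
  have hmul : formAlgebraToField K U (algebraMap R (formAlgebra U) d) * z = formAlgebraToField K U a := by
    have : formAlgebraToField K U (algebraMap R (formAlgebra U) d) = C (algebraMap R K d) :=
      map_C (algebraMap R K) d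
    rw [this, ← smul_eq_C_mul, hda, smul_inv_smul₀ hdK]
  have hd' : algebraMap (formAlgebra U) F (algebraMap R (formAlgebra U) d) ≠ 0 := by
    intro h0
    have h1 : algebraMap R (formAlgebra U) d = 0 :=
      IsFractionRing.injective (formAlgebra U) F (by rw [h0, map_zero])
    have h2 : C (σ := Fin e) d = 0 := congrArg Subtype.val h1
    exact hd (C_eq_zero.1 h2)
  let x : F := algebraMap _ F a / algebraMap _ F (algebraMap R (formAlgebra U) d)
  have hx : g x = algebraMap Q L z := by
    refine mul_left_cancel₀ ((map_ne_zero g).2 hd') ?_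
    rw [← map_mul, mul_div_cancel₀ _ hd', hg, hg]
    exact ((map_mul (algebraMap Q L) _ _).symm.trans (congrArg (algebraMap Q L) hmul)).symm
  have hxint : IsIntegral (formAlgebra U) x := by
    have h1 : f.IsIntegralElem (g x) := by
      rw [hx]
      exact RingHom.IsIntegralElem.map hz _
    rw [← show g.comp (algebraMap (formAlgebra U) F) = f from RingHom.ext hg] at h1
    exact RingHom.IsIntegralElem.of_map g.injective h1
  obtain ⟨b, hb⟩ := IsIntegrallyClosed.isIntegral_iff.1 hxint
  refine ⟨b, IsFractionRing.injective Q L ?_⟩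
  rw [← hx, ← hb, hg]
  rfl

end Normal

end ModuleRees

/-! ### Comparison of the two closures -/

open ModuleRees in
theorem proposition4p1 {R : Type*} [CommRing R] [IsDomain R] [IsIntegrallyClosed R]
    {E : Type*} [AddCommGroup E] [Module R E] [Module.Finite R E] [Module.IsTorsionFree R E]
    (φ : E →ₗ[R] (Fin (Module.finrank R E) → R)) (hφ : Function.Injective φ)
    (ψ : ∀ n : ℕ, ModuleRees.reesComp φ n →ₗ[R]
      (Fin (Module.finrank R (ModuleRees.reesComp φ n)) → R))
    (hψ : ∀ n : ℕ, Function.Injective (ψ n)) :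
    IsIntegrallyClosed (ModuleRees.reesAlg φ) ↔ ∀ n : ℕ, ModuleRees.IsIntClosed (ψ n) := by
  let K := FractionRing R
  let vec (n : ℕ) : reesComp φ n →ₗ[R] (Fin (Module.finrank R (reesComp φ n)) → K) :=
    (vecMap R K _).comp (ψ n)
  have hιinj : Function.Injective (MvPolynomial.map (σ := Fin (Module.finrank R E))
      (algebraMap R K)) := map_injective _ (IsFractionRing.injective R K)
  have hrees : ∀ n, Function.Injective (reesCompToField K φ n) := fun n =>
    hιinj.comp Subtype.val_injective
  have hvecMap : ∀ m, Function.Injective (vecMap R K m) := fun m a b h =>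
    funext fun i => IsFractionRing.injective R K (congrFun h i)
  have hvec : ∀ n, Function.Injective (vec n) := fun n => (hvecMap _).comp (hψ n)
  have hvecspan : ∀ n (V : ValuationSubring K),
      valSpan V (LinearMap.range (ψ n)) = Submodule.span V (Set.range (vec n)) := by
    intro n V
    rw [valSpan, LinearMap.coe_range, ← Set.range_comp]
    rfl
  have htop : ∀ r : R, algebraMap R K r ∈ (⊤ : ValuationSubring K) := fun r => trivial
  have hfgφ : (LinearMap.range φ).FG := by
    rw [LinearMap.range_eq_map]
    exact Module.Finite.fg_top.map _
  have hfgψ : ∀ n, (LinearMap.range (ψ n)).FG := fun n => by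
    rw [LinearMap.range_eq_map]
    exact Module.Finite.fg_top.map _
  have hspanφ := span_vecMap_range_eq_top (K := K) φ hφ
  have hspanψ := fun n => span_vecMap_range_eq_top (K := K) (ψ n) (hψ n)
  constructor
  · intro hA n
    have : IsIntegrallyClosed (formAlgebra (LinearMap.range φ)) := hA
    refine le_antisymm (fun v hv => ?_)
      ((isGreatest_modIntegralClosure _).1.1)
    rw [mem_modIntegralClosure_iff_isIntegralElem (K := K)] at hv
    have hmem : ∀ V : ValuationSubring K, (∀ r : R, algebraMap R K r ∈ V) →
        vecMap R K _ v ∈ Submodule.span V (Set.range (vec n)) := by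
      intro V hV
      have h1 := homogeneousComponent_mem_formSpan_pow (hfgψ n) (hspanψ n) hv V hV 1
      rwa [homogeneousComponent_of_mem (isHomogeneous_linForm _), if_pos rfl, pow_one,
        linForm_mem_formSpan, hvecspan] at h1
    -- The trivial valuation ring `V = K` supplies the fraction `a / d`; the others give its
    -- integrality in the other embedding.
    obtain ⟨d, a, hd, hda⟩ := Submodule.exists_eq_inv_smul_of_mem_span_range _ _ (hmem ⊤ htop)
    have hz := isIntegralElem_of_forall_mem (K := K) (U := LinearMap.range φ) (n := n)
      (z := (algebraMap R K d)⁻¹ • reesCompToField K φ n a) (fun V hV => by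
        rw [← span_range_reesCompToField φ n V hV]
        refine Submodule.smul_mem_span_range_of_injective V (hvec n) _ ?_
        rw [← hda]
        exact hmem V hV)
    obtain ⟨b, hb⟩ := mem_range_of_isIntegralElem hd
      (a := (⟨a, a.2.1⟩ : formAlgebra (LinearMap.range φ))) rfl hz
    have hdK : algebraMap R K d ≠ 0 := by simpa using hd
    -- The element `b` of the Rees algebra equals `a / d`, so it is homogeneous of degree `n` and `ψ
    -- n b` is the given vector.
    have hdb : d • (b : MvPolynomial (Fin (Module.finrank R E)) R) = a := by
      apply hιinj
      have h1 : C (algebraMap R K d) * MvPolynomial.map (algebraMap R K) (b : MvPolynomial (Fin (Module.finrank R E)) R) =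
          MvPolynomial.map (algebraMap R K) (a : MvPolynomial (Fin (Module.finrank R E)) R) := by
        rw [← formAlgebraToField_apply, hb, ← smul_eq_C_mul, smul_inv_smul₀ hdK]
        rfl
      rw [smul_eq_C_mul, map_mul, map_C, h1]
    have hbhom : (b : MvPolynomial (Fin (Module.finrank R E)) R).IsHomogeneous n := by
      refine IsHomogeneous.of_map (f := algebraMap R K) (IsFractionRing.injective R K) ?_
      rw [← formAlgebraToField_apply, hb, smul_eq_C_mul]
      have h1 := (isHomogeneous_C _ (algebraMap R K d)⁻¹).mul
        (IsHomogeneous.map (show (a : MvPolynomial (Fin (Module.finrank R E)) R).IsHomogeneous n from a.2.2)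
          (algebraMap R K))
      rwa [zero_add] at h1
    refine ⟨⟨b, b.2, hbhom⟩, hvecMap _ ?_⟩
    rw [hda]
    have h2 : a = d • (⟨b, b.2, hbhom⟩ : reesComp φ n) := Subtype.ext hdb.symm
    rw [h2, map_smul, ← algebraMap_smul K d, inv_smul_smul₀ hdK]
    rfl
  · intro hE
    refine isIntegrallyClosed_of_forall_isIntegralElem (K := K) fun z hz => ?_
    have hcomp : ∀ n, homogeneousComponent n z ∈
        (formAlgebraToField K (LinearMap.range φ)).range := by
      intro n
      have hmem : ∀ V : ValuationSubring K, (∀ r : R, algebraMap R K r ∈ V) →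
          homogeneousComponent n z ∈ Submodule.span V (Set.range (reesCompToField K φ n)) := by
        intro V hV
        rw [span_range_reesCompToField φ n V hV]
        exact homogeneousComponent_mem_formSpan_pow hfgφ hspanφ hz V hV n
      obtain ⟨d, a, hd, hda⟩ := Submodule.exists_eq_inv_smul_of_mem_span_range _ _ (hmem ⊤ htop)
      have hdK : algebraMap R K d ≠ 0 := by simpa using hd
      -- Degree `n` over the algebra of `E` becomes degree one over the algebra of `E_n`.
      have hint := isIntegralElem_of_forall_mem (K := K) (U := LinearMap.range (ψ n)) (n := 1)
        (z := linForm ((algebraMap R K d)⁻¹ • vec n a)) (fun V hV => by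
          rw [pow_one, linForm_mem_formSpan, hvecspan]
          refine Submodule.smul_mem_span_range_of_injective V (hrees n) _ ?_
          rw [← hda]
          exact hmem V hV)
      obtain ⟨v, hv⟩ : ∃ v, vecMap R K _ v = (algebraMap R K d)⁻¹ • vec n a := by
        exact exists_vecMap_eq_of_isIntegralElem hint
      rw [← hv, ← mem_modIntegralClosure_iff_isIntegralElem, hE n] at hint
      obtain ⟨b, rfl⟩ := hint
      have hdb : a = d • b := by
        apply hvec n
        rw [map_smul, ← algebraMap_smul K d]
        change _ = algebraMap R K d • vecMap R K _ (ψ n b)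
        rw [hv, smul_inv_smul₀ hdK]
      refine ⟨⟨b, b.2.1⟩, ?_⟩
      rw [hda, hdb, map_smul, ← algebraMap_smul K d, inv_smul_smul₀ hdK]
      rfl
    rw [← sum_homogeneousComponent z]
    exact sum_mem fun n _ => hcomp n
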